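/- **Setting.** An *orthocomplemented bisemilattice* (OCBSL) is a structure $(S,\wedge,\sqcup,\neg,0,1)$ satisfying, for all $x,y,z$: - L1, L1′: $x\sqcup y=y\sqcup x$, $x\wedge y=y\wedge x$; - L2, L2′: $x\sqcup(y\sqcup z)=(x\sqcup y)\sqcup z$, $x\wedge(y\wedge z)=(x\wedge y)\wedge z$; - L3, L3′: $x\sqcup x=x$, $x\wedge x=x$; - L4, L4′: $x\sqcup 1=1$, $x\wedge 0=0$; - L5, L5′: $x\sqcup 0=x$, $x\wedge 1=x$; - L6: $\neg\neg x=x$; - L7, L7′: $x\sqcup\neg x=1$, $x\wedge\neg x=0$; - L8, L8′: $\neg(x\sqcup y)=\neg x\wedge\neg y$, $\neg(x\wedge y)=\neg x\sqcup\neg y$. Fix a set $X$ of variables. *Binary terms* are the terms over $(\wedge,\sqcup,\neg,0,1)$ and $X$; write $\vdash s=t$ if $s=t$ is derivable in equational logic from L1–L8, L1′–L8′. *N-ary terms* are built from $X$, $0$, $1$, $\neg$ and $\bigsqcup(x_1,\dots,x_n)$ with $n\ge 1$. The de Morgan translation $s\mapsto s^\ast$ from binary to n-ary terms fixes variables, $0$,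 $1$, commutes with $\neg$, sends $x\sqcup y$ to $\bigsqcup(x^\ast,y^\ast)$ and $x\wedge y$ to $\neg\bigsqcup(\neg x^\ast,\neg y^\ast)$. Conversely, an n-ary term $p$ is read as a binary term $p^\circ$ by reading $\bigsqcup(x_1,\dots,x_n)$ as $x_1\sqcup(x_2\sqcup(\cdots\sqcup x_n))$. Consider n-ary terms modulo commutativity, that is, up to permuting the arguments of any occurrence of $\bigsqcup$ (A1), and let $\to$ be the relation on them of applying one of the following rules, from left to right, to one subterm (the vectors may be empty, provided that every $\bigsqcup$ has at least one argument): - A2: $\bigsqcup(\vec x,\bigsqcup(\vec y))\to\bigsqcup(\vec x,\vec y)$ and $\bigsqcup(x)\to x$; - A3: $\bigsqcup(x,x,\vec y)\to\bigsqcup(x,\vec y)$; - A4: $\bigsqcup(1,\vec x)\to 1$; - A5: $\bigsqcup(0,\vec x)\to\bigsqcup(\vec x)$; - A6: $\neg\neg x\to x$; - A7: $\bigsqcup(x,\neg x,\vec y)\to 1$; - A9: $\bigsqcup(\vec x,\vec y,\neg\bigsqcup(\vec y))\to 1$; - A10: $\neg 0\to 1$; - A11: $\neg 1\to 0$. Let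 $\to^\ast$ be the reflexive transitive closure of $\to$, and $\leftrightarrow^\ast$ the equivalence relation it generates. **Theorem.** 1. $\to$ is terminating (there is no infinite chain $t_1\to t_2\to\cdots$) and confluent (if $t\to^\ast t_1$ and $t\to^\ast t_2$, then $t_1\to^\ast t_3$ and $t_2\to^\ast t_3$ for some $t_3$). 2. The rewrite system is equivalent to the OCBSL axioms. For binary terms $s,t$: $\vdash s=t$ iff $s=t$ holds in all OCBSLs under all assignments, iff $s^\ast\leftrightarrow^\ast t^\ast$. For n-ary terms $p,q$: $p\leftrightarrow^\ast q$ iff $\vdash p^\circ=q^\circ$. Moreover $\vdash (s^\ast)^\circ=s$ and $(p^\circ)^\ast\leftrightarrow^\ast p$ for all binary terms $s$ and n-ary terms $p$. 3. Every n-ary term $p$, taken modulo commutativity, has a unique normal form $p{\downarrow}$, i.e. a unique irreducible term, modulo commutativity, to which it reduces. For binary terms $s,t$: $\vdash s=t$ iff $s^\ast{\downarrow}=t^\ast{\downarrow}$; for n-ary terms $p,q$: $\vdash p^\circ=q^\circ$ iff $p{\downarrow}=q{\downarrow}$. -/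

import Mathlib

universe u v

namespace OCBSL


/-! ### Orthocomplemented bisemilattices -/

/-- An orthocomplemented bisemilattice: a structure `(S, ⊓, ⊔, ¬, 0, 1)` satisfying the laws
L1-L8 and L1'-L8' (L6' is the same law as L6). -/
class OrthoBisemilattice (S : Type v) where
  sup : S → S → S
  inf : S → S → S
  neg : S → S
  zero : S
  one : S
  l1 : ∀ x y, sup x y = sup y x
  l1' : ∀ x y, inf x y = inf y x
  l2 : ∀ x y z, sup x (sup y z) = sup (sup x y) z
  l2' : ∀ x y z, inf x (inf y z) = inf (inf x y) z
  l3 : ∀ x, sup x x = x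
  l3' : ∀ x, inf x x = x
  l4 : ∀ x, sup x one = one
  l4' : ∀ x, inf x zero = zero
  l5 : ∀ x, sup x zero = x
  l5' : ∀ x, inf x one = x
  l6 : ∀ x, neg (neg x) = x
  l7 : ∀ x, sup x (neg x) = one
  l7' : ∀ x, inf x (neg x) = zero
  l8 : ∀ x y, neg (sup x y) = inf (neg x) (neg y)
  l8' : ∀ x y, neg (inf x y) = sup (neg x) (neg y)

/-- Terms in the signature `(∧, ⊔, ¬, 0, 1)` with variables in `X`. -/
inductive BTerm (X : Type u) : Type u
  | var (i : X) : BTerm X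
  | zero : BTerm X
  | one : BTerm X
  | neg (x : BTerm X) : BTerm X
  | sup (x y : BTerm X) : BTerm X
  | inf (x y : BTerm X) : BTerm X

/-- The value of a term in an orthocomplemented bisemilattice under an assignment `a`. -/
def BTerm.eval {X : Type u} {S : Type v} [OrthoBisemilattice S] (a : X → S) : BTerm X → S
  | .var i => a i
  | .zero => OrthoBisemilattice.zero
  | .one => OrthoBisemilattice.one
  | .neg x => OrthoBisemilattice.neg (x.eval a)
  | .sup x y => OrthoBisemilattice.sup (x.eval a) (y.eval a)
  | .inf x y => OrthoBisemilattice.inf (x.eval a) (y.eval a)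

/-- Substitution instances of the axioms L1-L8, L1'-L8'. -/
inductive Law {X : Type u} : BTerm X → BTerm X → Prop
  | l1 (x y : BTerm X) : Law (.sup x y) (.sup y x)
  | l1' (x y : BTerm X) : Law (.inf x y) (.inf y x)
  | l2 (x y z : BTerm X) : Law (.sup x (.sup y z)) (.sup (.sup x y) z)
  | l2' (x y z : BTerm X) : Law (.inf x (.inf y z)) (.inf (.inf x y) z)
  | l3 (x : BTerm X) : Law (.sup x x) x
  | l3' (x : BTerm X) : Law (.inf x x) x
  | l4 (x : BTerm X) : Law (.sup x .one) .one
  | l4' (x : BTerm X) : Law (.inf x .zero) .zero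
  | l5 (x : BTerm X) : Law (.sup x .zero) x
  | l5' (x : BTerm X) : Law (.inf x .one) x
  | l6 (x : BTerm X) : Law (.neg (.neg x)) x
  | l7 (x : BTerm X) : Law (.sup x (.neg x)) .one
  | l7' (x : BTerm X) : Law (.inf x (.neg x)) .zero
  | l8 (x y : BTerm X) : Law (.neg (.sup x y)) (.inf (.neg x) (.neg y))
  | l8' (x y : BTerm X) : Law (.neg (.inf x y)) (.sup (.neg x) (.neg y))

/-- `Derives s t`: the equation `s = t` is derivable from L1-L8, L1'-L8' in equational logic. -/
inductive Derives {X : Type u} : BTerm X → BTerm X → Prop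
  | law {s t : BTerm X} : Law s t → Derives s t
  | refl (s : BTerm X) : Derives s s
  | symm {s t : BTerm X} : Derives s t → Derives t s
  | trans {s t r : BTerm X} : Derives s t → Derives t r → Derives s r
  | neg {s t : BTerm X} : Derives s t → Derives (.neg s) (.neg t)
  | sup {s t s' t' : BTerm X} : Derives s t → Derives s' t' → Derives (.sup s s') (.sup t t')
  | inf {s t s' t' : BTerm X} : Derives s t → Derives s' t' → Derives (.inf s s') (.inf t t')

/-! ### Terms with an n-ary join, and the rewrite rules -/

/-- Terms in the signature `(⨆, ¬, 0, 1)`, where `⨆` takes any positive number of arguments: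
`join x [x₁, ..., xₙ]` is `⨆(x, x₁, ..., xₙ)`. -/
inductive NTerm (X : Type u) : Type u
  | var (i : X) : NTerm X
  | zero : NTerm X
  | one : NTerm X
  | neg (x : NTerm X) : NTerm X
  | join (x : NTerm X) (xs : List (NTerm X)) : NTerm X

/-- A1 at the root: the arguments of a `⨆` may be permuted. -/
inductive RuleA1 {X : Type u} : NTerm X → NTerm X → Prop
  | a1 {x y : NTerm X} {xs ys : List (NTerm X)} (h : (x :: xs).Perm (y :: ys)) :
      RuleA1 (.join x xs) (.join y ys)

/-- Root instances of the rules A2-A7, A9-A11, read from left to right. The vectors `xs`, `ys` may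
be empty as long as no `⨆` without arguments arises. The arguments of a `⨆` on the left-hand sides
are listed in a convenient order, which is immaterial because rewriting is modulo A1. -/
inductive Rule {X : Type u} : NTerm X → NTerm X → Prop
  | a2 (y : NTerm X) (ys xs : List (NTerm X)) :
      Rule (.join (.join y ys) xs) (.join y (ys ++ xs))
  | a2_single (x : NTerm X) : Rule (.join x []) x
  | a3 (x : NTerm X) (ys : List (NTerm X)) : Rule (.join x (x :: ys)) (.join x ys)
  | a4 (xs : List (NTerm X)) : Rule (.join .one xs) .one
  | a5 (x : NTerm X) (xs : List (NTerm X)) : Rule (.join .zero (x :: xs)) (.join x xs)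
  | a6 (x : NTerm X) : Rule (.neg (.neg x)) x
  | a7 (x : NTerm X) (ys : List (NTerm X)) : Rule (.join x (.neg x :: ys)) .one
  | a9 (y : NTerm X) (ys xs : List (NTerm X)) :
      Rule (.join y (ys ++ .neg (.join y ys) :: xs)) .one
  | a10 : Rule (.neg .zero) .one
  | a11 : Rule (.neg .one) .zero

/-- Closure of a relation on terms under contexts: one subterm is replaced. -/
inductive InContext {X : Type u} (R : NTerm X → NTerm X → Prop) : NTerm X → NTerm X → Prop
  | root {s t : NTerm X} : R s t → InContext R s t
  | neg {s t : NTerm X} : InContext R s t → InContext R (.neg s) (.neg t)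
  | head {s t : NTerm X} (xs : List (NTerm X)) :
      InContext R s t → InContext R (.join s xs) (.join t xs)
  | tail {s t : NTerm X} (x : NTerm X) (l r : List (NTerm X)) :
      InContext R s t → InContext R (.join x (l ++ s :: r)) (.join x (l ++ t :: r))

/-- Equality of n-ary terms modulo commutativity A1. -/
def commSetoid (X : Type u) : Setoid (NTerm X) :=
  Relation.EqvGen.setoid (InContext RuleA1)

/-- N-ary terms modulo commutativity A1. -/
abbrev CTerm (X : Type u) : Type u := Quotient (commSetoid X)

/-- The class of an n-ary term modulo commutativity. -/
def NTerm.cls {X : Type u} (t : NTerm X) : CTerm X := Quotient.mk (commSetoid X) t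

/-- One step of rewriting modulo commutativity: some representative of `p` rewrites to some
representative of `q` by applying a rule to a subterm. -/
def Step {X : Type u} (p q : CTerm X) : Prop :=
  ∃ s t : NTerm X, s.cls = p ∧ t.cls = q ∧ InContext Rule s t

/-! ### Abstract rewriting -/

/-- There is no infinite chain of reductions. -/
def Terminating {α : Type u} (r : α → α → Prop) : Prop :=
  ¬ ∃ f : ℕ → α, ∀ n, r (f n) (f (n + 1))

/-- Any two terms reached from a common term are joinable. -/
def Confluent {α : Type u} (r : α → α → Prop) : Prop :=
  ∀ a b c, Relation.ReflTransGen r a b → Relation.ReflTransGen r a c →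
    ∃ d, Relation.ReflTransGen r b d ∧ Relation.ReflTransGen r c d

/-- `n` is a normal form of `p`: `p` reduces to `n`, and `n` is irreducible. -/
def IsNormalFormOf {α : Type u} (r : α → α → Prop) (p n : α) : Prop :=
  Relation.ReflTransGen r p n ∧ ∀ m, ¬ r n m

/-! ### Translations between the two languages -/

/-- The de Morgan translation: binary joins become n-ary joins with two arguments, and
`x ∧ y` becomes `¬ ⨆(¬ x, ¬ y)`. -/
def BTerm.deMorgan {X : Type u} : BTerm X → NTerm X
  | .var i => .var i
  | .zero => .zero
  | .one => .one
  | .neg x => .neg x.deMorgan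
  | .sup x y => .join x.deMorgan [y.deMorgan]
  | .inf x y => .neg (.join (.neg x.deMorgan) [.neg y.deMorgan])

mutual

/-- An n-ary term read in the signature `(∧, ⊔, ¬, 0, 1)`, with
`⨆(x₀, x₁, ..., xₙ)` read as `x₀ ⊔ (x₁ ⊔ (... ⊔ xₙ))`. -/
def NTerm.toBTerm {X : Type u} : NTerm X → BTerm X
  | .var i => .var i
  | .zero => .zero
  | .one => .one
  | .neg x => .neg x.toBTerm
  | .join x xs => NTerm.joinToBTerm x.toBTerm xs

/-- `b ⊔ (x₁ ⊔ (... ⊔ xₙ))`, which is `b` when the list is empty. -/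
def NTerm.joinToBTerm {X : Type u} : BTerm X → List (NTerm X) → BTerm X
  | b, [] => b
  | b, x :: xs => .sup b (NTerm.joinToBTerm x.toBTerm xs)

end

end OCBSL

namespace OCBSL

-- Termination is a symbol count: every rule strictly decreases `NTerm.size`, which A1 preserves.
--
-- Confluence is not obtained from critical pairs. A function `NTerm.nf` computes a candidate normal
-- form by recursion: normalize the arguments of a join, pool their parts into a finite set, return
-- `1` if the set is `Contradictory` and its join otherwise. Two facts suffice. First, `nf` is
-- constant along A1 and along every step (`NTerm.nf_eq_of_rule`, `NTerm.nf_eq_of_inContext`).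
-- Second, an irreducible term is its own `nf` (`NTerm.nf_eq_cls_of_irreducible`). Hence every
-- normal form of `p` equals `nf p`; termination provides one, and confluence, uniqueness and the
-- decision of convertibility follow. The delicate point is the interplay of flattening with A7 and
-- A9, settled by `CTerm.IsNf.contradictory`.
--
-- For the equational theory, steps are sound in every algebra, and the free algebra turns validity
-- into derivability. Conversely the translation of each axiom is a conversion, and the two
-- translations are mutually inverse up to provable equality and convertibility.

variable {X : Type u}

/-! ### Terms modulo commutativity -/

/-- Induction on n-ary terms, with the arguments of a join treated uniformly. -/
theorem NTerm.inductionOn {P : NTerm X → Prop} (t : NTerm X) (var : ∀ i, P (.var i))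
    (zero : P .zero) (one : P .one) (neg : ∀ x, P x → P (.neg x))
    (join : ∀ x xs, (∀ y ∈ x :: xs, P y) → P (.join x xs)) : P t :=
  NTerm.rec (motive_1 := P) (motive_2 := fun l => ∀ y ∈ l, P y) var zero one neg
    (fun x xs hx hxs => join x xs (List.forall_mem_cons.2 ⟨hx, hxs⟩))
    (by simp) (fun _ _ hx hxs => List.forall_mem_cons.2 ⟨hx, hxs⟩) t

theorem NTerm.cls_eq_of_inContext {s t : NTerm X} (h : InContext RuleA1 s t) : s.cls = t.cls :=
  Quotient.sound (Relation.EqvGen.rel _ _ h)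

/-- A function that is invariant under A1 takes equal values on equal classes. -/
theorem NTerm.congr_of_cls_eq {α : Type*} (f : NTerm X → α)
    (hf : ∀ s t, InContext RuleA1 s t → f s = f t) {s t : NTerm X} (h : s.cls = t.cls) :
    f s = f t := by
  have h' : Relation.EqvGen (InContext RuleA1) s t := Quotient.exact h
  clear h
  induction h' with
  | rel s t h => exact hf s t h
  | refl => rfl
  | symm _ _ _ ih => exact ih.symm
  | trans _ _ _ _ _ ih₁ ih₂ => exact ih₁.trans ih₂

theorem NTerm.cls_out (c : CTerm X) : NTerm.cls c.out = c := Quotient.out_eq c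

theorem NTerm.cls_neg {s t : NTerm X} (h : s.cls = t.cls) : (neg s).cls = (neg t).cls :=
  congr_of_cls_eq (fun s => (neg s).cls) (fun _ _ h => cls_eq_of_inContext h.neg) h

theorem NTerm.cls_join_head {s t : NTerm X} (xs : List (NTerm X)) (h : s.cls = t.cls) :
    (join s xs).cls = (join t xs).cls :=
  congr_of_cls_eq (fun s => (join s xs).cls) (fun _ _ h => cls_eq_of_inContext (h.head xs)) h

/-- Arguments are exchanged one at a time; the prefix `l` collects those already exchanged. -/
theorem NTerm.cls_join_tail {xs ys : List (NTerm X)} (x : NTerm X) (l : List (NTerm X))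
    (h : xs.map cls = ys.map cls) : (join x (l ++ xs)).cls = (join x (l ++ ys)).cls := by
  induction xs generalizing ys l with
  | nil =>
    cases ys with
    | nil => rfl
    | cons _ _ => simp at h
  | cons a xs ih =>
    cases ys with
    | nil => simp at h
    | cons b ys =>
      simp only [List.map_cons, List.cons.injEq] at h
      calc (join x (l ++ a :: xs)).cls = (join x (l ++ b :: xs)).cls :=
            congr_of_cls_eq (fun s => (join x (l ++ s :: xs)).cls)
              (fun _ _ h => cls_eq_of_inContext (h.tail x l xs)) h.1
        _ = _ := by simpa using ih (l ++ [b]) h.2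

/-- The join of a list of terms, which is `0` for the empty list. -/
def NTerm.joinList : List (NTerm X) → NTerm X
  | [] => zero
  | x :: xs => join x xs

theorem NTerm.cls_joinList {xs ys : List (NTerm X)} (h : xs.map cls = ys.map cls) :
    (joinList xs).cls = (joinList ys).cls := by
  cases xs <;> cases ys <;> simp only [List.map_nil, List.map_cons, reduceCtorEq,
    List.cons.injEq] at h
  · rfl
  · exact (cls_join_head _ h.1).trans (cls_join_tail _ [] h.2)

theorem NTerm.cls_joinList_perm {xs ys : List (NTerm X)} (h : xs.Perm ys) :
    (joinList xs).cls = (joinList ys).cls := by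
  cases xs with
  | nil => rw [List.nil_perm.1 h]
  | cons x xs =>
    cases ys with
    | nil => simp at h
    | cons y ys => exact cls_eq_of_inContext (.root (.a1 h))

namespace CTerm

/-- Negation of terms modulo commutativity. -/
def neg : CTerm X → CTerm X :=
  Quotient.lift (fun s => (NTerm.neg s).cls) fun _ _ h => NTerm.cls_neg (Quotient.sound h)

/-- The join of a multiset of terms modulo commutativity, which is `0` for the empty one. -/
noncomputable def join : Multiset (CTerm X) → CTerm X :=
  Quotient.lift (fun L => (NTerm.joinList (L.map Quotient.out)).cls)
    fun _ _ h => NTerm.cls_joinList_perm (List.Perm.map _ h)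

theorem neg_cls (t : NTerm X) : neg t.cls = (NTerm.neg t).cls := rfl

theorem join_map_cls (xs : List (NTerm X)) :
    join (xs.map NTerm.cls : Multiset (CTerm X)) = (NTerm.joinList xs).cls :=
  NTerm.cls_joinList (by simp [Function.comp_def, NTerm.cls_out])

theorem join_cons_cls (x : NTerm X) (xs : List (NTerm X)) :
    join ((x :: xs).map NTerm.cls : Multiset (CTerm X)) = (NTerm.join x xs).cls :=
  join_map_cls _

theorem exists_list_eq (M : Multiset (CTerm X)) :
    ∃ xs : List (NTerm X), M = (xs.map NTerm.cls : Multiset (CTerm X)) := by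
  refine ⟨M.toList.map Quotient.out, ?_⟩
  simp [Function.comp_def, NTerm.cls_out]

end CTerm

/-! ### Size and termination -/

mutual

/-- The number of symbols of a term. -/
def NTerm.size : NTerm X → ℕ
  | .var _ => 1
  | .zero => 1
  | .one => 1
  | .neg x => x.size + 1
  | .join x xs => x.size + NTerm.sizeList xs + 1

/-- The total number of symbols of a list of terms. -/
def NTerm.sizeList : List (NTerm X) → ℕ
  | [] => 0
  | x :: xs => x.size + NTerm.sizeList xs

end

theorem NTerm.size_pos (t : NTerm X) : 0 < t.size := by
  cases t <;> simp [size]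

theorem NTerm.sizeList_eq (xs : List (NTerm X)) : sizeList xs = (xs.map size).sum := by
  induction xs with
  | nil => rfl
  | cons x xs ih => simp [sizeList, ih]

theorem NTerm.size_join (x : NTerm X) (xs : List (NTerm X)) :
    (join x xs).size = ((x :: xs).map size).sum + 1 := by
  simp [size, sizeList_eq]

theorem NTerm.size_eq_of_inContext {s t : NTerm X} (h : InContext RuleA1 s t) :
    s.size = t.size := by
  induction h with
  | root h =>
    cases h with
    | a1 h => rw [size_join, size_join, (h.map size).sum_eq]
  | neg _ ih => simp [size, ih]
  | head _ _ ih => simp [size, ih]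
  | tail _ _ _ _ ih => simp [size, sizeList_eq, ih]

/-- Flattening loses a join symbol, and A3 loses a copy of an argument, which is why positivity of
sizes enters. -/
theorem NTerm.size_lt_of_rule {s t : NTerm X} (h : Rule s t) : t.size < s.size := by
  cases h with
  | a3 x ys => have := x.size_pos; simp only [size, sizeList]; omega
  | a7 x ys => have := x.size_pos; simp only [size]; omega
  | a9 y ys xs => have := y.size_pos; simp only [size]; omega
  | _ => simp [size, sizeList_eq] <;> omega

theorem NTerm.size_lt_of_inContext {s t : NTerm X} (h : InContext Rule s t) :
    t.size < s.size := by
  induction h with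
  | root h => exact size_lt_of_rule h
  | neg _ ih => simpa [size] using ih
  | head _ _ ih => simpa [size] using ih
  | tail _ _ _ _ ih => simpa [size, sizeList_eq] using ih

/-- The number of symbols of a term modulo commutativity. -/
def CTerm.size : CTerm X → ℕ :=
  Quotient.lift NTerm.size fun _ _ h =>
    NTerm.congr_of_cls_eq _ (fun _ _ => NTerm.size_eq_of_inContext) (Quotient.sound h)

theorem CTerm.size_cls (t : NTerm X) : CTerm.size t.cls = t.size := rfl

theorem CTerm.size_neg (c : CTerm X) : CTerm.size (CTerm.neg c) = CTerm.size c + 1 := by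
  induction c using Quotient.inductionOn with | h t => rfl

/-- Needed later to see that the negation of a join is never one of the arguments of that join. -/
theorem CTerm.size_lt_join {c : CTerm X} {M : Multiset (CTerm X)} (h : c ∈ M) :
    CTerm.size c < CTerm.size (CTerm.join M) := by
  obtain ⟨xs, rfl⟩ := CTerm.exists_list_eq M
  cases xs with
  | nil => simp at h
  | cons x xs =>
    rw [CTerm.join_cons_cls, CTerm.size_cls, NTerm.size_join]
    obtain ⟨y, hy, rfl⟩ := List.mem_map.1 (Multiset.mem_coe.1 h)
    exact Nat.lt_succ_of_le (List.le_sum_of_mem (List.mem_map_of_mem hy))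

theorem Step.size_lt {p q : CTerm X} (h : Step p q) : CTerm.size q < CTerm.size p := by
  obtain ⟨s, t, rfl, rfl, h⟩ := h
  exact NTerm.size_lt_of_inContext h

theorem terminating_step : Terminating (Step (X := X)) := by
  rintro ⟨f, hf⟩
  have key : ∀ n, CTerm.size (f n) + n ≤ CTerm.size (f 0) := by
    intro n
    induction n with
    | zero => simp
    | succ n ih => have := (hf n).size_lt; omega
  have := key (CTerm.size (f 0) + 1)
  omega

theorem exists_isNormalFormOf (p : CTerm X) : ∃ n, IsNormalFormOf Step p n := by
  induction h : CTerm.size p using Nat.strong_induction_on generalizing p with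
  | _ k ih =>
    by_cases hp : ∃ q, Step p q
    · obtain ⟨q, hq⟩ := hp
      obtain ⟨n, hn, hn'⟩ := ih _ (h ▸ hq.size_lt) q rfl
      exact ⟨n, .head hq hn, hn'⟩
    · exact ⟨p, .refl, fun m hm => hp ⟨m, hm⟩⟩

/-! ### Steps between composite terms -/

theorem Step.neg {p q : CTerm X} (h : Step p q) : Step (CTerm.neg p) (CTerm.neg q) := by
  obtain ⟨s, t, rfl, rfl, h⟩ := h
  exact ⟨_, _, rfl, rfl, h.neg⟩

theorem Step.join_cons {p q : CTerm X} (h : Step p q) (M : Multiset (CTerm X)) :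
    Step (CTerm.join (p ::ₘ M)) (CTerm.join (q ::ₘ M)) := by
  obtain ⟨s, t, rfl, rfl, h⟩ := h
  obtain ⟨xs, rfl⟩ := CTerm.exists_list_eq M
  exact ⟨_, _, (CTerm.join_cons_cls s xs).symm, (CTerm.join_cons_cls t xs).symm, h.head xs⟩

theorem step_of_rule {s t : NTerm X} (h : Rule s t) : Step s.cls t.cls :=
  ⟨s, t, rfl, rfl, .root h⟩

namespace CTerm

/-- The empty join is `0` by convention, not a join, so A2 does not apply to it. -/
theorem step_join_join {N : Multiset (CTerm X)} (hN : N ≠ 0) (M : Multiset (CTerm X)) :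
    Step (join (join N ::ₘ M)) (join (N + M)) := by
  obtain ⟨ys, rfl⟩ := exists_list_eq N
  obtain ⟨xs, rfl⟩ := exists_list_eq M
  cases ys with
  | nil => simp at hN
  | cons y ys =>
    have := step_of_rule (Rule.a2 y ys xs)
    rw [← join_cons_cls, ← join_cons_cls, List.map_cons, ← join_cons_cls] at this
    simpa using this

theorem step_join_dup (c : CTerm X) (M : Multiset (CTerm X)) :
    Step (join (c ::ₘ c ::ₘ M)) (join (c ::ₘ M)) := by
  obtain ⟨xs, rfl⟩ := exists_list_eq M
  induction c using Quotient.inductionOn with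
  | h x =>
    have := step_of_rule (Rule.a3 x xs)
    rw [← join_cons_cls, ← join_cons_cls] at this
    exact this

theorem step_join_singleton (c : CTerm X) : Step (join {c}) c := by
  induction c using Quotient.inductionOn with
  | h x =>
    have := step_of_rule (Rule.a2_single x)
    rw [← join_cons_cls] at this
    exact this

theorem step_join_one (M : Multiset (CTerm X)) :
    Step (join (NTerm.one.cls ::ₘ M)) NTerm.one.cls := by
  obtain ⟨xs, rfl⟩ := exists_list_eq M
  have := step_of_rule (Rule.a4 xs)
  rw [← join_cons_cls] at this
  exact this

theorem step_join_zero {M : Multiset (CTerm X)} (hM : M ≠ 0) :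
    Step (join (NTerm.zero.cls ::ₘ M)) (join M) := by
  obtain ⟨xs, rfl⟩ := exists_list_eq M
  cases xs with
  | nil => simp at hM
  | cons x xs =>
    have := step_of_rule (Rule.a5 x xs)
    rw [← join_cons_cls, ← join_cons_cls] at this
    exact this

theorem step_neg_neg (c : CTerm X) : Step (neg (neg c)) c := by
  induction c using Quotient.inductionOn with
  | h x => exact step_of_rule (Rule.a6 x)

theorem step_join_neg (c : CTerm X) (M : Multiset (CTerm X)) :
    Step (join (c ::ₘ neg c ::ₘ M)) NTerm.one.cls := by
  obtain ⟨xs, rfl⟩ := exists_list_eq M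
  induction c using Quotient.inductionOn with
  | h x =>
    have := step_of_rule (Rule.a7 x xs)
    rw [← join_cons_cls] at this
    exact this

theorem step_join_neg_join {N : Multiset (CTerm X)} (hN : N ≠ 0) (M : Multiset (CTerm X)) :
    Step (join (N + neg (join N) ::ₘ M)) NTerm.one.cls := by
  obtain ⟨ys, rfl⟩ := exists_list_eq N
  obtain ⟨xs, rfl⟩ := exists_list_eq M
  cases ys with
  | nil => simp at hN
  | cons y ys =>
    have := step_of_rule (Rule.a9 y ys xs)
    rw [← join_cons_cls, List.map_cons, List.map_append, List.map_cons, ← neg_cls,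
      ← join_cons_cls] at this
    simpa using this

end CTerm

/-! ### The equational theory -/

namespace OrthoBisemilattice

variable {S : Type v} [OrthoBisemilattice S]

/-- The join of a list. -/
def supList : List S → S
  | [] => zero
  | x :: xs => sup x (supList xs)

theorem zero_sup (x : S) : sup zero x = x := by rw [l1, l5]

theorem one_sup (x : S) : sup one x = one := by rw [l1, l4]

theorem supList_append (xs ys : List S) : supList (xs ++ ys) = sup (supList xs) (supList ys) := by
  induction xs with
  | nil => simp [supList, zero_sup]
  | cons x xs ih => simp [supList, ih, l2]

theorem supList_perm {xs ys : List S} (h : xs.Perm ys) : supList xs = supList ys := by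
  induction h with
  | nil => rfl
  | cons x _ ih => simp [supList, ih]
  | swap x y l => simp only [supList]; rw [l2, l2, l1 y x]
  | trans _ _ ih₁ ih₂ => exact ih₁.trans ih₂

theorem neg_zero : neg (zero : S) = one := by
  rw [← l7 (zero : S), zero_sup]

theorem neg_one : neg (one : S) = zero := by
  rw [← neg_zero, l6]

end OrthoBisemilattice

open OrthoBisemilattice in
theorem NTerm.eval_joinToBTerm {S : Type v} [OrthoBisemilattice S] (a : X → S) (b : BTerm X)
    (xs : List (NTerm X)) : (joinToBTerm b xs).eval a =
      OrthoBisemilattice.sup (b.eval a) (supList (xs.map fun x => x.toBTerm.eval a)) := by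
  induction xs generalizing b with
  | nil => simp [joinToBTerm, supList, l5]
  | cons x xs ih => simp [joinToBTerm, BTerm.eval, ih, supList]

open OrthoBisemilattice in
theorem NTerm.eval_join {S : Type v} [OrthoBisemilattice S] (a : X → S) (x : NTerm X)
    (xs : List (NTerm X)) : (join x xs).toBTerm.eval a =
      supList ((x :: xs).map fun x => x.toBTerm.eval a) := by
  simp [toBTerm, eval_joinToBTerm, supList]

open OrthoBisemilattice in
theorem Derives.sound {S : Type v} [OrthoBisemilattice S] (a : X → S) {s t : BTerm X}
    (h : Derives s t) : s.eval a = t.eval a := by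
  induction h with
  | law h =>
    cases h <;> simp only [BTerm.eval]
    exacts [l1 _ _, l1' _ _, l2 _ _ _, l2' _ _ _, l3 _, l3' _, l4 _, l4' _, l5 _, l5' _, l6 _,
      l7 _, l7' _, l8 _ _, l8' _ _]
  | refl => rfl
  | symm _ ih => exact ih.symm
  | trans _ _ ih₁ ih₂ => exact ih₁.trans ih₂
  | neg _ ih => simp only [BTerm.eval, ih]
  | sup _ _ ih₁ ih₂ => simp only [BTerm.eval, ih₁, ih₂]
  | inf _ _ ih₁ ih₂ => simp only [BTerm.eval, ih₁, ih₂]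

/-- Derivable equality of terms. -/
def derivesSetoid (X : Type u) : Setoid (BTerm X) :=
  ⟨Derives, .refl, .symm, .trans⟩

/-- The free orthocomplemented bisemilattice: terms modulo derivable equality. -/
abbrev FreeAlgebra (X : Type u) : Type u := Quotient (derivesSetoid X)

instance : OrthoBisemilattice (FreeAlgebra X) where
  sup := Quotient.map₂ .sup fun _ _ h _ _ h' => Derives.sup h h'
  inf := Quotient.map₂ .inf fun _ _ h _ _ h' => Derives.inf h h'
  neg := Quotient.map .neg fun _ _ h => Derives.neg h
  zero := Quotient.mk _ .zero
  one := Quotient.mk _ .one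
  l1 := by rintro ⟨x⟩ ⟨y⟩; exact Quotient.sound (.law (.l1 x y))
  l1' := by rintro ⟨x⟩ ⟨y⟩; exact Quotient.sound (.law (.l1' x y))
  l2 := by rintro ⟨x⟩ ⟨y⟩ ⟨z⟩; exact Quotient.sound (.law (.l2 x y z))
  l2' := by rintro ⟨x⟩ ⟨y⟩ ⟨z⟩; exact Quotient.sound (.law (.l2' x y z))
  l3 := by rintro ⟨x⟩; exact Quotient.sound (.law (.l3 x))
  l3' := by rintro ⟨x⟩; exact Quotient.sound (.law (.l3' x))
  l4 := by rintro ⟨x⟩; exact Quotient.sound (.law (.l4 x))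
  l4' := by rintro ⟨x⟩; exact Quotient.sound (.law (.l4' x))
  l5 := by rintro ⟨x⟩; exact Quotient.sound (.law (.l5 x))
  l5' := by rintro ⟨x⟩; exact Quotient.sound (.law (.l5' x))
  l6 := by rintro ⟨x⟩; exact Quotient.sound (.law (.l6 x))
  l7 := by rintro ⟨x⟩; exact Quotient.sound (.law (.l7 x))
  l7' := by rintro ⟨x⟩; exact Quotient.sound (.law (.l7' x))
  l8 := by rintro ⟨x⟩ ⟨y⟩; exact Quotient.sound (.law (.l8 x y))
  l8' := by rintro ⟨x⟩ ⟨y⟩; exact Quotient.sound (.law (.l8' x y))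

/-- The copy of an orthocomplemented bisemilattice in a larger universe. -/
instance {S : Type u} [OrthoBisemilattice S] : OrthoBisemilattice (ULift.{v} S) where
  sup x y := ⟨OrthoBisemilattice.sup x.down y.down⟩
  inf x y := ⟨OrthoBisemilattice.inf x.down y.down⟩
  neg x := ⟨OrthoBisemilattice.neg x.down⟩
  zero := ⟨OrthoBisemilattice.zero⟩
  one := ⟨OrthoBisemilattice.one⟩
  l1 _ _ := congrArg ULift.up (OrthoBisemilattice.l1 _ _)
  l1' _ _ := congrArg ULift.up (OrthoBisemilattice.l1' _ _)
  l2 _ _ _ := congrArg ULift.up (OrthoBisemilattice.l2 _ _ _)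
  l2' _ _ _ := congrArg ULift.up (OrthoBisemilattice.l2' _ _ _)
  l3 _ := congrArg ULift.up (OrthoBisemilattice.l3 _)
  l3' _ := congrArg ULift.up (OrthoBisemilattice.l3' _)
  l4 _ := congrArg ULift.up (OrthoBisemilattice.l4 _)
  l4' _ := congrArg ULift.up (OrthoBisemilattice.l4' _)
  l5 _ := congrArg ULift.up (OrthoBisemilattice.l5 _)
  l5' _ := congrArg ULift.up (OrthoBisemilattice.l5' _)
  l6 _ := congrArg ULift.up (OrthoBisemilattice.l6 _)
  l7 _ := congrArg ULift.up (OrthoBisemilattice.l7 _)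
  l7' _ := congrArg ULift.up (OrthoBisemilattice.l7' _)
  l8 _ _ := congrArg ULift.up (OrthoBisemilattice.l8 _ _)
  l8' _ _ := congrArg ULift.up (OrthoBisemilattice.l8' _ _)

/-- Under the generic assignment a term evaluates to its own class, so an equation valid in the free
algebra is derivable. -/
theorem FreeAlgebra.eval_mk (s : BTerm X) :
    s.eval (fun i => (Quotient.mk _ (.var i) : FreeAlgebra X)) = Quotient.mk _ s := by
  induction s with
  | var | zero | one => rfl
  | neg x ih => simp only [BTerm.eval, ih]; rfl
  | sup x y ihx ihy => simp only [BTerm.eval, ihx, ihy]; rfl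
  | inf x y ihx ihy => simp only [BTerm.eval, ihx, ihy]; rfl

theorem BTerm.eval_up {S : Type u} [OrthoBisemilattice S] (a : X → S) (s : BTerm X) :
    s.eval (fun i => ULift.up.{v} (a i)) = ULift.up (s.eval a) := by
  induction s with
  | var | zero | one => rfl
  | neg x ih => simp only [BTerm.eval, ih]; rfl
  | sup x y ihx ihy => simp only [BTerm.eval, ihx, ihy]; rfl
  | inf x y ihx ihy => simp only [BTerm.eval, ihx, ihy]; rfl

theorem derives_of_eval_eq {s t : BTerm X}
    (h : ∀ a : X → FreeAlgebra X, s.eval a = t.eval a) : Derives s t := by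
  have := h fun i => Quotient.mk _ (.var i)
  rw [FreeAlgebra.eval_mk, FreeAlgebra.eval_mk] at this
  exact Quotient.exact this

theorem derives_iff_valid (s t : BTerm X) : Derives s t ↔
    ∀ (S : Type (max u v)) [OrthoBisemilattice S] (a : X → S), s.eval a = t.eval a := by
  refine ⟨fun h S _ a => h.sound a, fun h => derives_of_eval_eq fun a => ?_⟩
  -- The free algebra lives in `Type u`; lifting it brings it into the universe of the hypothesis.
  have := h (ULift.{v} (FreeAlgebra X)) fun i => ULift.up (a i)
  rw [BTerm.eval_up, BTerm.eval_up] at this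
  exact ULift.up_injective this

/-! ### Soundness of rewriting -/

section

variable {S : Type v} [OrthoBisemilattice S] (a : X → S)

theorem eval_eq_of_inContext {R : NTerm X → NTerm X → Prop}
    (hR : ∀ s t, R s t → s.toBTerm.eval a = t.toBTerm.eval a) {s t : NTerm X}
    (h : InContext R s t) : s.toBTerm.eval a = t.toBTerm.eval a := by
  induction h with
  | root h => exact hR _ _ h
  | neg _ ih => simp only [NTerm.toBTerm, BTerm.eval, ih]
  | head _ _ ih => simp only [NTerm.eval_join, List.map_cons, ih]
  | tail _ _ _ _ ih => simp only [NTerm.eval_join, List.map_cons, List.map_append, ih]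

theorem eval_eq_of_ruleA1 (s t : NTerm X) (h : RuleA1 s t) :
    s.toBTerm.eval a = t.toBTerm.eval a := by
  cases h with
  | a1 h =>
    rw [NTerm.eval_join, NTerm.eval_join]
    exact OrthoBisemilattice.supList_perm (h.map _)

open OrthoBisemilattice in
theorem eval_eq_of_rule (s t : NTerm X) (h : Rule s t) :
    s.toBTerm.eval a = t.toBTerm.eval a := by
  cases h with
  | a2 y ys xs =>
    simp only [NTerm.eval_join, List.map_cons, List.map_append, supList, supList_append, l2]
  | a2_single x => simp [NTerm.eval_join, supList, l5]
  | a3 x ys => simp only [NTerm.eval_join, List.map_cons, supList]; rw [l2, l3]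
  | a4 xs => simp [NTerm.toBTerm, NTerm.eval_joinToBTerm, BTerm.eval, one_sup]
  | a5 x xs => simp [NTerm.toBTerm, NTerm.eval_joinToBTerm, supList, BTerm.eval, zero_sup]
  | a6 x => simp [NTerm.toBTerm, BTerm.eval, l6]
  | a7 x ys => simp [NTerm.toBTerm, NTerm.eval_joinToBTerm, supList, BTerm.eval, l2, l7, one_sup]
  | a9 y ys xs =>
    simp only [List.map_cons, List.map_append, supList, supList_append,
      NTerm.toBTerm, BTerm.eval, NTerm.eval_joinToBTerm]
    -- Regrouping puts the join of `y :: ys` next to its negation; L7 makes this `1`, which absorbs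
    -- the rest.
    rw [l2, l2, l7, one_sup]
  | a10 => simp [NTerm.toBTerm, BTerm.eval, OrthoBisemilattice.neg_zero]
  | a11 => simp [NTerm.toBTerm, BTerm.eval, OrthoBisemilattice.neg_one]

theorem eval_eq_of_eqvGen {p q : NTerm X} (h : Relation.EqvGen Step p.cls q.cls) :
    p.toBTerm.eval a = q.toBTerm.eval a := by
  have hA1 := @eval_eq_of_inContext X S _ a _ (eval_eq_of_ruleA1 a)
  -- Evaluation must descend to classes, since the intermediate terms of a conversion are classes.
  let f : CTerm X → S := Quotient.lift (fun p => p.toBTerm.eval a) fun _ _ h =>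
    NTerm.congr_of_cls_eq (fun p => p.toBTerm.eval a) (fun _ _ => hA1) (Quotient.sound h)
  have key : ∀ c d, Relation.EqvGen Step c d → f c = f d := by
    intro c d h
    induction h with
    | rel c d h =>
      obtain ⟨s, t, rfl, rfl, h⟩ := h
      exact eval_eq_of_inContext a (eval_eq_of_rule a) h
    | refl => rfl
    | symm _ _ _ ih => exact ih.symm
    | trans _ _ _ _ _ ih₁ ih₂ => exact ih₁.trans ih₂
  exact key _ _ h

end

theorem derives_of_eqvGen {p q : NTerm X} (h : Relation.EqvGen Step p.cls q.cls) :
    Derives p.toBTerm q.toBTerm :=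
  derives_of_eval_eq fun a => eval_eq_of_eqvGen a h

theorem derives_deMorgan_toBTerm (s : BTerm X) : Derives s.deMorgan.toBTerm s := by
  induction s with
  | var | zero | one => exact .refl _
  | neg x ih => exact ih.neg
  | sup x y ihx ihy => exact ihx.sup ihy
  | inf x y ihx ihy =>
    exact (Derives.neg (.sup ihx.neg ihy.neg)).trans
      ((Derives.law (.l8 _ _)).trans (.inf (.law (.l6 _)) (.law (.l6 _))))

/-! ### Convertibility of n-ary terms -/

/-- Convertibility of n-ary terms by rewriting modulo commutativity. -/
def Conv (p q : NTerm X) : Prop := Relation.EqvGen Step p.cls q.cls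

namespace Conv

theorem refl (p : NTerm X) : Conv p p := Relation.EqvGen.refl _

theorem symm {p q : NTerm X} (h : Conv p q) : Conv q p := Relation.EqvGen.symm _ _ h

theorem trans {p q r : NTerm X} (h : Conv p q) (h' : Conv q r) : Conv p r :=
  Relation.EqvGen.trans _ _ _ h h'

theorem of_cls_eq {p q : NTerm X} (h : p.cls = q.cls) : Conv p q := by
  rw [Conv, h]; exact Relation.EqvGen.refl _

theorem rule {p q : NTerm X} (h : Rule p q) : Conv p q :=
  Relation.EqvGen.rel _ _ (step_of_rule h)

theorem perm {x y : NTerm X} {xs ys : List (NTerm X)} (h : (x :: xs).Perm (y :: ys)) :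
    Conv (.join x xs) (.join y ys) :=
  of_cls_eq (NTerm.cls_eq_of_inContext (.root (.a1 h)))

theorem map (f : CTerm X → CTerm X) (hf : ∀ c d, Step c d → Step (f c) (f d)) {c d : CTerm X}
    (h : Relation.EqvGen Step c d) : Relation.EqvGen Step (f c) (f d) := by
  induction h with
  | rel c d h => exact .rel _ _ (hf _ _ h)
  | refl => exact .refl _
  | symm _ _ _ ih => exact .symm _ _ ih
  | trans _ _ _ _ _ ih₁ ih₂ => exact .trans _ _ _ ih₁ ih₂

theorem neg {p q : NTerm X} (h : Conv p q) : Conv (.neg p) (.neg q) :=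
  map CTerm.neg (fun _ _ => Step.neg) h

theorem head {p q : NTerm X} (h : Conv p q) (xs : List (NTerm X)) :
    Conv (.join p xs) (.join q xs) := by
  have := map (fun c => CTerm.join (c ::ₘ (xs.map NTerm.cls : Multiset (CTerm X))))
    (fun _ _ h => h.join_cons _) h
  simp only [Multiset.cons_coe, ← List.map_cons, CTerm.join_cons_cls] at this
  exact this

theorem pair {p q p' q' : NTerm X} (h : Conv p q) (h' : Conv p' q') :
    Conv (.join p [p']) (.join q [q']) :=
  (h.head _).trans (.trans (perm (.swap _ _ _)) ((h'.head _).trans (perm (.swap _ _ _))))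

/-- A2 is stated for a nested join in first position; A1 moves it there and back. -/
theorem flatten (x y : NTerm X) (ys : List (NTerm X)) :
    Conv (.join x [.join y ys]) (.join x (y :: ys)) := by
  refine (perm (.swap _ _ _)).trans ((rule (.a2 y ys [x])).trans (perm ?_))
  exact List.perm_append_comm (l₁ := y :: ys) (l₂ := [x])

/-- A meet law becomes the dual join law on negated arguments under an outer negation, with A6, A10
and A11 clearing the extra negations. The two de Morgan laws reduce to A6 alone. -/
theorem deMorgan_of_law {s t : BTerm X} (h : Law s t) : Conv s.deMorgan t.deMorgan := by
  have inner : ∀ x y : NTerm X,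
      Conv (.neg (.neg (.join x [y]))) (.join x [y]) := fun x y => rule (.a6 _)
  have assoc : ∀ x y z : NTerm X,
      Conv (.join x [.join y [z]]) (.join (.join x [y]) [z]) := fun x y z =>
    (flatten x y [z]).trans (rule (.a2 x [y] [z])).symm
  have dup : ∀ x : NTerm X, Conv (.join x [x]) x := fun x =>
    (rule (.a3 x [])).trans (rule (.a2_single x))
  have top : ∀ x : NTerm X, Conv (.join x [.one]) .one := fun x =>
    (perm (.swap _ _ _)).trans (rule (.a4 [x]))
  have bot : ∀ x : NTerm X, Conv (.join x [.zero]) x := fun x =>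
    (perm (.swap _ _ _)).trans ((rule (.a5 x [])).trans (rule (.a2_single x)))
  cases h with
  | l1 x y => exact perm (.swap _ _ _)
  | l1' x y => exact (perm (.swap _ _ _)).neg
  | l2 x y z => exact assoc _ _ _
  | l2' x y z =>
    exact (((refl _).pair (inner _ _)).trans ((assoc _ _ _).trans
      ((inner _ _).symm.pair (refl _)))).neg
  | l3 x => exact dup _
  | l3' x => exact (dup _).neg.trans (rule (.a6 _))
  | l4 x => exact top _
  | l4' x => exact ((((refl _).pair (rule .a10)).trans (top _)).neg).trans (rule .a11)
  | l5 x => exact bot _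
  | l5' x => exact ((((refl _).pair (rule .a11)).trans (bot _)).neg).trans (rule (.a6 _))
  | l6 x => exact rule (.a6 _)
  | l7 x => exact rule (.a7 _ [])
  | l7' x => exact (rule (.a7 _ [])).neg.trans (rule .a11)
  | l8 x y => exact ((rule (.a6 _)).symm.pair (rule (.a6 _)).symm).neg
  | l8' x y => exact rule (.a6 _)

theorem deMorgan_of_derives {s t : BTerm X} (h : Derives s t) : Conv s.deMorgan t.deMorgan := by
  induction h with
  | law h => exact deMorgan_of_law h
  | refl => exact refl _
  | symm _ ih => exact ih.symm
  | trans _ _ ih₁ ih₂ => exact ih₁.trans ih₂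
  | neg _ ih => exact ih.neg
  | sup _ _ ih₁ ih₂ => exact ih₁.pair ih₂
  | inf _ _ ih₁ ih₂ => exact (ih₁.neg.pair ih₂.neg).neg

theorem joinToBTerm_deMorgan (b : BTerm X) (x : NTerm X) (xs : List (NTerm X))
    (hb : Conv b.deMorgan x) (hxs : ∀ y ∈ xs, Conv y.toBTerm.deMorgan y) :
    Conv (NTerm.joinToBTerm b xs).deMorgan (.join x xs) := by
  induction xs generalizing b x with
  | nil => exact hb.trans (rule (.a2_single x)).symm
  | cons y ys ih =>
    have hy := List.forall_mem_cons.1 hxs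
    exact (hb.pair (ih _ y hy.1 hy.2)).trans (flatten x y ys)

theorem toBTerm_deMorgan (p : NTerm X) : Conv p.toBTerm.deMorgan p := by
  induction p using NTerm.inductionOn with
  | var | zero | one => exact refl _
  | neg x ih => exact ih.neg
  | join x xs ih =>
    have h := List.forall_mem_cons.1 ih
    exact joinToBTerm_deMorgan _ x xs h.1 h.2

end Conv

theorem conv_iff_derives (p q : NTerm X) : Conv p q ↔ Derives p.toBTerm q.toBTerm :=
  ⟨derives_of_eqvGen, fun h => (Conv.toBTerm_deMorgan p).symm.trans
    ((Conv.deMorgan_of_derives h).trans (Conv.toBTerm_deMorgan q))⟩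

theorem derives_iff_conv (s t : BTerm X) : Derives s t ↔ Conv s.deMorgan t.deMorgan :=
  ⟨Conv.deMorgan_of_derives, fun h => (derives_deMorgan_toBTerm s).symm.trans
    ((derives_of_eqvGen h).trans (derives_deMorgan_toBTerm t))⟩

/-! ### The normal form of a term -/

open scoped Classical in
/-- The arguments of a join; a term that is neither `0` nor a join is its own only argument. -/
noncomputable def NTerm.parts : NTerm X → Finset (CTerm X)
  | .var i => {(var i).cls}
  | .zero => ∅
  | .one => {one.cls}
  | .neg x => {(neg x).cls}
  | .join x xs => ((x :: xs).map cls).toFinset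

open scoped Classical in
theorem NTerm.parts_eq_of_inContext {s t : NTerm X} (h : InContext RuleA1 s t) :
    s.parts = t.parts := by
  cases h with
  | root h =>
    cases h with
    | a1 h => exact List.toFinset_eq_of_perm _ _ (h.map cls)
  | neg h => simp only [parts, cls_eq_of_inContext h.neg]
  | head xs h => simp only [parts, List.map_cons, cls_eq_of_inContext h]
  | tail x l r h => simp only [parts, List.map_cons, List.map_append, cls_eq_of_inContext h]

/-- The argument of a negation. -/
def NTerm.negArg : NTerm X → Option (CTerm X)
  | .neg x => some x.cls
  | _ => none

theorem NTerm.negArg_eq_of_inContext {s t : NTerm X} (h : InContext RuleA1 s t) :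
    s.negArg = t.negArg := by
  cases h with
  | root h => cases h; rfl
  | neg h => simp only [negArg, cls_eq_of_inContext h]
  | head | tail => rfl

theorem NTerm.cls_one_ne_cls_var (i : X) : (one : NTerm X).cls ≠ (var i).cls := by
  intro h
  have := congr_of_cls_eq (fun t : NTerm X => match t with | .one => true | _ => false) ?_ h
  · simp at this
  · intro s t h
    cases h with
    | root h => cases h; rfl
    | neg | head | tail => rfl

namespace CTerm

/-- The arguments of a join; a term that is neither `0` nor a join is its own only argument. -/
noncomputable def parts : CTerm X → Finset (CTerm X) :=
  Quotient.lift NTerm.parts fun _ _ h =>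
    NTerm.congr_of_cls_eq _ (fun _ _ => NTerm.parts_eq_of_inContext) (Quotient.sound h)

/-- The argument of a negation. -/
def negArg : CTerm X → Option (CTerm X) :=
  Quotient.lift NTerm.negArg fun _ _ h =>
    NTerm.congr_of_cls_eq _ (fun _ _ => NTerm.negArg_eq_of_inContext) (Quotient.sound h)

theorem parts_cls (t : NTerm X) : parts t.cls = t.parts := rfl

theorem parts_zero : parts (NTerm.zero : NTerm X).cls = ∅ := rfl

theorem parts_one : parts (NTerm.one : NTerm X).cls = {NTerm.one.cls} := rfl

theorem parts_neg (c : CTerm X) : parts (neg c) = {neg c} := by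
  induction c using Quotient.inductionOn with | h t => rfl

theorem negArg_neg (c : CTerm X) : negArg (neg c) = some c := by
  induction c using Quotient.inductionOn with | h t => rfl

theorem neg_injective : Function.Injective (neg (X := X)) := fun c d h => by
  simpa [negArg_neg] using congrArg negArg h

theorem eq_neg_of_negArg {c d : CTerm X} (h : negArg c = some d) : c = neg d := by
  induction c using Quotient.inductionOn with
  | h t => cases t with
    | neg x => exact congrArg neg (Option.some.inj h)
    | _ => exact absurd h (by rintro ⟨⟩)

theorem neg_ne_of_negArg {c d : CTerm X} (h : negArg d = none) : neg c ≠ d := by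
  rintro rfl
  simp [negArg_neg] at h

theorem neg_ne_zero (c : CTerm X) : neg c ≠ NTerm.zero.cls := neg_ne_of_negArg rfl

theorem neg_ne_one (c : CTerm X) : neg c ≠ NTerm.one.cls := neg_ne_of_negArg rfl

theorem one_ne_zero : (NTerm.one : NTerm X).cls ≠ NTerm.zero.cls := fun h => by
  simpa [parts_zero, parts_one] using congrArg parts h

theorem neg_ne_self (c : CTerm X) : neg c ≠ c := fun h => by
  have := congrArg size h
  rw [size_neg] at this
  omega

open scoped Classical in
theorem parts_join {M : Multiset (CTerm X)} (h : M ≠ 0) : parts (join M) = M.toFinset := by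
  obtain ⟨xs, rfl⟩ := exists_list_eq M
  cases xs with
  | nil => simp at h
  | cons x xs => rw [join_cons_cls]; rfl

open scoped Classical in
/-- The join of a finite set of terms, which is the term itself for a singleton. -/
noncomputable def ofParts (S : Finset (CTerm X)) : CTerm X :=
  if h : ∃ c, S = {c} then h.choose else join S.val

theorem ofParts_singleton (c : CTerm X) : ofParts {c} = c := by
  have h : ∃ d, ({c} : Finset (CTerm X)) = {d} := ⟨c, rfl⟩
  rw [ofParts, dif_pos h]
  exact (Finset.singleton_injective h.choose_spec).symm

theorem ofParts_of_ne {S : Finset (CTerm X)} (h : ∀ c, S ≠ {c}) : ofParts S = join S.val := by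
  rw [ofParts, dif_neg (by simpa using h)]

theorem ofParts_empty : ofParts (∅ : Finset (CTerm X)) = NTerm.zero.cls := by
  rw [ofParts_of_ne fun c => (Finset.singleton_ne_empty c).symm]
  rfl

/-- Flatness matters only for a singleton, where no join is formed and the parts are those of the
element itself. -/
theorem parts_ofParts {S : Finset (CTerm X)} (h : ∀ c ∈ S, parts c = {c}) :
    parts (ofParts S) = S := by
  classical
  by_cases hS : ∃ c, S = {c}
  · obtain ⟨c, rfl⟩ := hS
    rw [ofParts_singleton]
    exact h c (Finset.mem_singleton_self c)
  · rcases S.eq_empty_or_nonempty with rfl | hne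
    · rw [ofParts_empty, parts_zero]
    · rw [ofParts_of_ne (by simpa using hS), parts_join (by simpa using hne.ne_empty)]
      exact Finset.val_toFinset S

/-- A set of terms whose join is `1` because of one of its elements, or of a subset together with
the negation of its join. -/
def Contradictory (S : Finset (CTerm X)) : Prop :=
  NTerm.one.cls ∈ S ∨ ∃ T ⊆ S, T.Nonempty ∧ neg (ofParts T) ∈ S

theorem Contradictory.mono {S T : Finset (CTerm X)} (h : Contradictory S) (hST : S ⊆ T) :
    Contradictory T := by
  rcases h with h | ⟨U, hU, hne, h⟩
  · exact .inl (hST h)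
  · exact .inr ⟨U, hU.trans hST, hne, hST h⟩

open scoped Classical in
/-- The normal form of a negation of a normal form. -/
noncomputable def negNf (c : CTerm X) : CTerm X :=
  if c = NTerm.zero.cls then NTerm.one.cls
  else if c = NTerm.one.cls then NTerm.zero.cls
  else (negArg c).getD (neg c)

open scoped Classical in
/-- The normal form of a join, given the arguments after flattening. -/
noncomputable def joinNf (S : Finset (CTerm X)) : CTerm X :=
  if Contradictory S then NTerm.one.cls else ofParts S

theorem joinNf_of_contradictory {S : Finset (CTerm X)} (h : Contradictory S) :
    joinNf S = NTerm.one.cls := if_pos h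

theorem joinNf_of_not_contradictory {S : Finset (CTerm X)} (h : ¬ Contradictory S) :
    joinNf S = ofParts S := if_neg h

theorem negNf_zero : negNf (NTerm.zero : NTerm X).cls = NTerm.one.cls := if_pos rfl

theorem negNf_one : negNf (NTerm.one : NTerm X).cls = NTerm.zero.cls := by
  rw [negNf, if_neg one_ne_zero, if_pos rfl]

theorem negNf_neg (c : CTerm X) : negNf (neg c) = c := by
  rw [negNf, if_neg (neg_ne_zero c), if_neg (neg_ne_one c), negArg_neg, Option.getD_some]

theorem negNf_of_negArg {c : CTerm X} (h₀ : c ≠ NTerm.zero.cls) (h₁ : c ≠ NTerm.one.cls)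
    (h : negArg c = none) : negNf c = neg c := by
  rw [negNf, if_neg h₀, if_neg h₁, h, Option.getD_none]

/-- The terms in normal form. -/
inductive IsNf : CTerm X → Prop
  | one : IsNf NTerm.one.cls
  | var (i : X) : IsNf (NTerm.var i).cls
  | neg {c : CTerm X} : IsNf c → c ≠ NTerm.zero.cls → c ≠ NTerm.one.cls → negArg c = none →
      IsNf (neg c)
  | ofParts {S : Finset (CTerm X)} : (∀ c ∈ S, IsNf c) → (∀ c ∈ S, parts c = {c}) →
      ¬ Contradictory S → IsNf (ofParts S)

theorem isNf_zero : IsNf (NTerm.zero : NTerm X).cls := by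
  rw [← ofParts_empty]
  exact .ofParts (by simp) (by simp) (by simp [Contradictory])

theorem not_contradictory_singleton {c : CTerm X} (h₁ : NTerm.one.cls ≠ c) :
    ¬ Contradictory {c} := by
  rintro (h' | ⟨T, hT, hne, h'⟩)
  · exact h₁ (Finset.mem_singleton.1 h')
  · rw [Finset.Nonempty.subset_singleton_iff hne] at hT
    rw [hT, ofParts_singleton, Finset.mem_singleton] at h'
    exact neg_ne_self c h'

/-- The term `1` fits too: its set of parts is contradictory, which returns `1`. -/
theorem IsNf.joinNf_parts {c : CTerm X} (h : IsNf c) : joinNf (parts c) = c := by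
  cases h with
  | one => exact joinNf_of_contradictory (.inl (Finset.mem_singleton_self _))
  | var i =>
    rw [parts_cls, NTerm.parts, joinNf_of_not_contradictory, ofParts_singleton]
    exact not_contradictory_singleton (NTerm.cls_one_ne_cls_var i)
  | @neg c =>
    rw [parts_neg, joinNf_of_not_contradictory, ofParts_singleton]
    exact not_contradictory_singleton (neg_ne_one c).symm
  | ofParts h hp hc => rw [parts_ofParts hp, joinNf_of_not_contradictory hc]

/-- One round of flattening is enough: the parts of a normal form are again normal and cannot be
flattened further. -/
theorem IsNf.of_mem_parts {c d : CTerm X} (h : IsNf c) (hd : d ∈ parts c) :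
    IsNf d ∧ parts d = {d} := by
  cases h with
  | one => rw [Finset.mem_singleton.1 hd]; exact ⟨.one, rfl⟩
  | var i => rw [Finset.mem_singleton.1 hd]; exact ⟨.var i, rfl⟩
  | neg h h₀ h₁ hn =>
    rw [parts_neg] at hd
    rw [Finset.mem_singleton.1 hd]
    exact ⟨.neg h h₀ h₁ hn, parts_neg _⟩
  | ofParts h hp hc =>
    rw [parts_ofParts hp] at hd
    exact ⟨h d hd, hp d hd⟩

theorem IsNf.joinNf {S : Finset (CTerm X)} (h : ∀ c ∈ S, IsNf c ∧ parts c = {c}) :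
    IsNf (joinNf S) := by
  by_cases hS : Contradictory S
  · rw [joinNf_of_contradictory hS]; exact .one
  · rw [joinNf_of_not_contradictory hS]
    exact .ofParts (fun c hc => (h c hc).1) (fun c hc => (h c hc).2) hS

theorem IsNf.cases_neg {c : CTerm X} (h : IsNf c) :
    c = NTerm.zero.cls ∨ c = NTerm.one.cls ∨
      (∃ d, c = CTerm.neg d ∧ IsNf d ∧ d ≠ NTerm.zero.cls ∧ d ≠ NTerm.one.cls ∧
        negArg d = none) ∨
      (c ≠ NTerm.zero.cls ∧ c ≠ NTerm.one.cls ∧ negArg c = none) := by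
  by_cases h₀ : c = NTerm.zero.cls
  · exact .inl h₀
  by_cases h₁ : c = NTerm.one.cls
  · exact .inr (.inl h₁)
  refine .inr (.inr ?_)
  cases hn : negArg c with
  | none => exact .inr ⟨h₀, h₁, rfl⟩
  | some d =>
    obtain rfl := eq_neg_of_negArg hn
    refine .inl ⟨d, rfl, ?_⟩
    generalize hc : CTerm.neg d = c at h
    clear h₀ h₁ hn
    -- Case analysis is not enough: `neg d` may also arise as `ofParts` of the singleton `{neg d}`,
    -- possibly repeatedly.
    induction h with
    | one => exact absurd hc (neg_ne_one d)
    | var i => exact absurd hc (neg_ne_of_negArg rfl)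
    | neg h h₀ h₁ hn => rw [neg_injective hc]; exact ⟨h, h₀, h₁, hn⟩
    | @ofParts S h hp _ ih =>
      have hS := parts_ofParts hp
      rw [← hc, parts_neg] at hS
      exact ih (CTerm.neg d) (hS ▸ Finset.mem_singleton_self _) rfl

theorem IsNf.negNf {c : CTerm X} (h : IsNf c) : IsNf (negNf c) := by
  rcases h.cases_neg with rfl | rfl | ⟨d, rfl, hd, -⟩ | ⟨h₀, h₁, hn⟩
  · rw [negNf_zero]; exact .one
  · rw [negNf_one]; exact isNf_zero
  · rwa [negNf_neg]
  · rw [negNf_of_negArg h₀ h₁ hn]; exact .neg h h₀ h₁ hn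

/-- Invariance under A6. Normality is essential: on the class of `¬0` the double application gives
`1`. -/
theorem IsNf.negNf_negNf {c : CTerm X} (h : IsNf c) :
    CTerm.negNf (CTerm.negNf c) = c := by
  rcases h.cases_neg with rfl | rfl | ⟨d, rfl, hd, h₀, h₁, hn⟩ | ⟨h₀, h₁, hn⟩
  · rw [negNf_zero, negNf_one]
  · rw [negNf_one, negNf_zero]
  · rw [negNf_neg, negNf_of_negArg h₀ h₁ hn]
  · rw [negNf_of_negArg h₀ h₁ hn, negNf_neg]

theorem IsNf.ofParts_parts {c : CTerm X} (h : IsNf c) : CTerm.ofParts (parts c) = c := by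
  by_cases hc : Contradictory (parts c)
  · have := h.joinNf_parts
    rw [joinNf_of_contradictory hc] at this
    rw [← this, parts_one, ofParts_singleton]
  · rw [← joinNf_of_not_contradictory hc, h.joinNf_parts]

theorem IsNf.parts_nonempty {c : CTerm X} (h : IsNf c) (h₀ : c ≠ NTerm.zero.cls) :
    (parts c).Nonempty := by
  rw [Finset.nonempty_iff_ne_empty]
  intro he
  apply h₀
  rw [← h.ofParts_parts, he, ofParts_empty]

/-- The common core of A7 and A9 after flattening. If `c` is `0` or `1`, then `1` lies in `S`.
Otherwise one of `c` and its normalized negation is `neg d` with `d` the other; the parts of `d`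
form the required subset, since their join is `d` again, and `neg d` is its own only part. -/
theorem IsNf.contradictory {c : CTerm X} (h : IsNf c) {S : Finset (CTerm X)}
    (h₁ : parts c ⊆ S) (h₂ : parts (CTerm.negNf c) ⊆ S) : Contradictory S := by
  have key : ∀ d : CTerm X, IsNf d → d ≠ NTerm.zero.cls → parts d ⊆ S →
      parts (CTerm.neg d) ⊆ S → Contradictory S := fun d hd h₀ h₁ h₂ => by
    refine .inr ⟨parts d, h₁, hd.parts_nonempty h₀, h₂ ?_⟩
    rw [hd.ofParts_parts, parts_neg]
    exact Finset.mem_singleton_self _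
  rcases h.cases_neg with rfl | rfl | ⟨d, rfl, hd, hd₀, -⟩ | ⟨hc₀, hc₁, hn⟩
  · rw [negNf_zero] at h₂
    exact .inl (h₂ (Finset.mem_singleton_self _))
  · exact .inl (h₁ (Finset.mem_singleton_self _))
  · rw [negNf_neg] at h₂
    exact key d hd hd₀ h₂ h₁
  · rw [negNf_of_negArg hc₀ hc₁ hn] at h₂
    exact key c h hc₀ h₁ h₂

end CTerm

open scoped Classical in
mutual

/-- The normal form of a term. -/
noncomputable def NTerm.nf : NTerm X → CTerm X
  | .var i => (var i).cls
  | .zero => zero.cls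
  | .one => one.cls
  | .neg x => CTerm.negNf x.nf
  | .join x xs => CTerm.joinNf (CTerm.parts x.nf ∪ NTerm.nfParts xs)

/-- The arguments of the join of a list of terms, after normalization and flattening. -/
noncomputable def NTerm.nfParts : List (NTerm X) → Finset (CTerm X)
  | [] => ∅
  | x :: xs => CTerm.parts x.nf ∪ NTerm.nfParts xs

end

namespace NTerm

theorem nf_join (x : NTerm X) (xs : List (NTerm X)) :
    (join x xs).nf = CTerm.joinNf (nfParts (x :: xs)) := by
  simp only [nf, nfParts]

theorem mem_nfParts {c : CTerm X} {xs : List (NTerm X)} :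
    c ∈ nfParts xs ↔ ∃ x ∈ xs, c ∈ CTerm.parts x.nf := by
  induction xs with
  | nil => simp [nfParts]
  | cons x xs ih => simp [nfParts, ih]

theorem parts_subset_nfParts {x : NTerm X} {xs : List (NTerm X)} (h : x ∈ xs) :
    CTerm.parts x.nf ⊆ nfParts xs := fun _ hc => mem_nfParts.2 ⟨x, h, hc⟩

theorem nfParts_mono {xs ys : List (NTerm X)} (h : xs ⊆ ys) : nfParts xs ⊆ nfParts ys :=
  fun c hc => by
    obtain ⟨x, hx, hc⟩ := mem_nfParts.1 hc
    exact mem_nfParts.2 ⟨x, h hx, hc⟩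

theorem nfParts_perm {xs ys : List (NTerm X)} (h : xs.Perm ys) : nfParts xs = nfParts ys :=
  (nfParts_mono h.subset).antisymm (nfParts_mono h.symm.subset)

theorem isNf_nf (t : NTerm X) : CTerm.IsNf t.nf := by
  induction t using inductionOn with
  | var i => exact .var i
  | zero => exact CTerm.isNf_zero
  | one => exact .one
  | neg x ih => simpa only [nf] using ih.negNf
  | join x xs ih =>
    rw [nf_join]
    refine .joinNf fun c hc => ?_
    obtain ⟨y, hy, hc⟩ := mem_nfParts.1 hc
    exact (ih y hy).of_mem_parts hc

/-- Unless a join collapses to `1`, normalizing it keeps its pooled parts visible to an enclosing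
join. -/
theorem parts_nf_join {y : NTerm X} {ys : List (NTerm X)}
    (h : ¬ CTerm.Contradictory (nfParts (y :: ys))) :
    CTerm.parts (join y ys).nf = nfParts (y :: ys) := by
  rw [nf_join, CTerm.joinNf_of_not_contradictory h, CTerm.parts_ofParts]
  intro c hc
  obtain ⟨y, -, hc⟩ := mem_nfParts.1 hc
  exact (y.isNf_nf.of_mem_parts hc).2

theorem nf_join_of_parts {x : NTerm X} {xs : List (NTerm X)} {y : NTerm X}
    (h : nfParts (x :: xs) = CTerm.parts y.nf) : (join x xs).nf = y.nf := by
  rw [nf_join, h, y.isNf_nf.joinNf_parts]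

theorem nf_join_of_one_mem {x : NTerm X} {xs : List (NTerm X)} {y : NTerm X}
    (hy : y ∈ x :: xs) (h : y.nf = NTerm.one.cls) :
    CTerm.Contradictory (nfParts (x :: xs)) :=
  .inl (parts_subset_nfParts hy (by rw [h]; exact Finset.mem_singleton_self _))

theorem nf_eq_of_rule {s t : NTerm X} (h : Rule s t) : s.nf = t.nf := by
  classical
  cases h with
  | a2 y ys xs =>
    rw [nf_join, nf_join]
    -- If the inner join collapses, the left side has `1` among its parts and the right side
    -- contains the same contradiction; otherwise both sides pool the same parts.
    by_cases h : CTerm.Contradictory (nfParts (y :: ys))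
    · rw [CTerm.joinNf_of_contradictory, CTerm.joinNf_of_contradictory]
      · exact h.mono (nfParts_mono (by simp))
      · exact nf_join_of_one_mem List.mem_cons_self
          ((nf_join y ys).trans (CTerm.joinNf_of_contradictory h))
    · congr 1
      ext c
      rw [nfParts, parts_nf_join h]
      simp [mem_nfParts, or_and_right, exists_or, or_assoc]
  | a2_single x => exact nf_join_of_parts (by simp [nfParts])
  | a3 x ys =>
    rw [nf_join, nf_join]
    congr 1
    simp [nfParts]
  | a4 xs =>
    rw [nf_join, CTerm.joinNf_of_contradictory (nf_join_of_one_mem List.mem_cons_self (by rw [nf]))]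
    rw [nf]
  | a5 x xs =>
    rw [nf_join, nf_join]
    congr 1
    rw [nfParts, nf, CTerm.parts_zero, Finset.empty_union]
  | a6 => rw [nf, nf, t.isNf_nf.negNf_negNf]
  | a7 x ys =>
    rw [nf_join, CTerm.joinNf_of_contradictory, nf]
    refine x.isNf_nf.contradictory (parts_subset_nfParts (by simp)) ?_
    have := parts_subset_nfParts (x := neg x) (xs := x :: neg x :: ys) (by simp)
    rwa [nf] at this
  | a9 y ys xs =>
    rw [nf_join, CTerm.joinNf_of_contradictory, nf]
    -- Either the listed arguments are already contradictory, or they supply all parts of the inner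
    -- join, whose negation is also present.
    by_cases h : CTerm.Contradictory (nfParts (y :: ys))
    · exact h.mono (nfParts_mono (by simp))
    · refine (join y ys).isNf_nf.contradictory ?_ ?_
      · rw [parts_nf_join h]
        exact nfParts_mono (by simp)
      · have := parts_subset_nfParts (x := neg (join y ys))
          (xs := y :: (ys ++ neg (join y ys) :: xs)) (by simp)
        rwa [nf] at this
  | a10 => rw [nf, nf, nf, CTerm.negNf_zero]
  | a11 => rw [nf, nf, nf, CTerm.negNf_one]

/-- `nf` is compositional, so invariance at the root passes to contexts; this serves both A1 and the
rules. -/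
theorem nf_eq_of_inContext {R : NTerm X → NTerm X → Prop} (hR : ∀ s t, R s t → s.nf = t.nf)
    {s t : NTerm X} (h : InContext R s t) : s.nf = t.nf := by
  induction h with
  | root h => exact hR _ _ h
  | neg _ ih => simp only [nf, ih]
  | head _ _ ih => simp only [nf, ih]
  | tail x l r _ ih =>
    rw [nf_join, nf_join]
    congr 1
    ext c
    simp [mem_nfParts, or_and_right, exists_or, ih]

theorem nf_eq_of_ruleA1 (s t : NTerm X) (h : RuleA1 s t) : s.nf = t.nf := by
  cases h with
  | a1 h => rw [nf_join, nf_join, nfParts_perm h]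

end NTerm

namespace CTerm

/-- The normal form of a term modulo commutativity. -/
noncomputable def nf : CTerm X → CTerm X :=
  Quotient.lift NTerm.nf fun _ _ h => NTerm.congr_of_cls_eq _
    (fun _ _ => NTerm.nf_eq_of_inContext NTerm.nf_eq_of_ruleA1) (Quotient.sound h)

theorem nf_eq_of_step {p q : CTerm X} (h : Step p q) : nf p = nf q := by
  obtain ⟨s, t, rfl, rfl, h⟩ := h
  exact NTerm.nf_eq_of_inContext (fun _ _ => NTerm.nf_eq_of_rule) h

theorem nf_eq_of_eqvGen {p q : CTerm X} (h : Relation.EqvGen Step p q) : nf p = nf q := by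
  induction h with
  | rel _ _ h => exact nf_eq_of_step h
  | refl => rfl
  | symm _ _ _ ih => exact ih.symm
  | trans _ _ _ _ _ ih₁ ih₂ => exact ih₁.trans ih₂

/-! ### Irreducible terms are normal forms -/

theorem nodup_of_irreducible {M : Multiset (CTerm X)} (h : ∀ m, ¬ Step (join M) m) :
    M.Nodup := by
  classical
  rw [Multiset.nodup_iff_le]
  intro c hc
  obtain ⟨N, rfl⟩ := Multiset.le_iff_exists_add.1 hc
  exact h _ (by simpa using step_join_dup c N)

open scoped Classical in
-- Each form of contradiction is a redex: A4 for `1`, A7 for a one-element subset, A9 for a larger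
-- one.
theorem not_contradictory_of_irreducible {M : Multiset (CTerm X)}
    (h : ∀ m, ¬ Step (join M) m) : ¬ Contradictory M.toFinset := by
  have hM := nodup_of_irreducible h
  rintro (h₁ | ⟨T, hT, hne, hn⟩)
  · obtain ⟨N, rfl⟩ := Multiset.exists_cons_of_mem (Multiset.mem_toFinset.1 h₁)
    exact h _ (step_join_one N)
  rw [Multiset.mem_toFinset] at hn
  have hle : T.val ≤ M := (Multiset.le_iff_subset T.nodup).2 fun c hc =>
    Multiset.mem_toFinset.1 (hT hc)
  obtain ⟨N, rfl⟩ := Multiset.le_iff_exists_add.1 hle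
  -- The rules need the negation as an argument besides those of `T`; by size it cannot lie in `T`.
  have hN : neg (ofParts T) ∉ T → ∃ N', N = neg (ofParts T) ::ₘ N' := fun hT' =>
    Multiset.exists_cons_of_mem ((Multiset.mem_add.1 hn).resolve_left hT')
  by_cases hs : ∃ c, T = {c}
  · obtain ⟨c, rfl⟩ := hs
    rw [ofParts_singleton] at hN
    obtain ⟨N', rfl⟩ := hN (by simpa using neg_ne_self c)
    exact h _ (step_join_neg c N')
  · have hT' := ofParts_of_ne (S := T) (by simpa using hs)
    rw [hT'] at hN
    obtain ⟨N', rfl⟩ := hN fun hmem => by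
      have := size_lt_join (M := T.val) hmem
      rw [size_neg] at this
      omega
    exact h _ (step_join_neg_join (by simpa using hne.ne_empty) N')

end CTerm

/-- The rules suffice: wherever `nf` would alter a term whose proper subterms are already normal,
some rule applies. -/
theorem NTerm.nf_eq_cls_of_irreducible {t : NTerm X} (h : ∀ m, ¬ Step t.cls m) :
    t.nf = t.cls := by
  classical
  induction t using inductionOn with
  | var i => rfl
  | zero => rfl
  | one => rfl
  | neg x ih =>
    have hx := ih fun m hm => h _ hm.neg
    rw [nf, hx, CTerm.negNf_of_negArg, CTerm.neg_cls]
    · intro h₀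
      apply h NTerm.one.cls
      rw [← CTerm.neg_cls, h₀]
      exact step_of_rule .a10
    · intro h₁
      apply h NTerm.zero.cls
      rw [← CTerm.neg_cls, h₁]
      exact step_of_rule .a11
    · cases hn : CTerm.negArg x.cls with
      | none => rfl
      | some d =>
        refine absurd (CTerm.step_neg_neg d) ?_
        rw [← CTerm.eq_neg_of_negArg hn]
        exact h d
  | join x xs ih =>
    rw [← CTerm.join_cons_cls] at h ⊢
    generalize hl : x :: xs = l at *
    -- No join has a single argument, so `ofParts` will rebuild an actual join.
    have hne : ∀ c, (l.map cls : Multiset (CTerm X)) ≠ {c} := fun c hc =>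
      h c (by rw [hc]; exact CTerm.step_join_singleton c)
    -- A5 excludes `0` as an argument and A2 excludes a join, so pooling changes nothing.
    have hparts : ∀ y ∈ l, CTerm.parts y.nf = {y.cls} := fun y hy => by
      obtain ⟨N, hN⟩ := Multiset.exists_cons_of_mem
        (Multiset.mem_coe.2 (List.mem_map_of_mem (f := cls) hy))
      rw [hN] at h hne
      rw [ih y hy fun m hm => h _ (hm.join_cons N)]
      cases y with
      | var | one | neg => rfl
      | zero =>
        refine absurd (CTerm.step_join_zero ?_) (h _)
        rintro rfl
        exact hne _ rfl
      | join z zs =>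
        rw [← CTerm.join_cons_cls] at h
        exact absurd (CTerm.step_join_join (by simp) N) (h _)
    have hS : nfParts l = (l.map cls : Multiset (CTerm X)).toFinset := by
      ext c
      rw [mem_nfParts]
      simp only [Multiset.mem_toFinset, Multiset.mem_coe, List.mem_map]
      refine exists_congr fun y => and_congr_right fun hy => ?_
      rw [hparts y hy, Finset.mem_singleton, eq_comm]
    -- By A3 there are no repetitions, so passing to a set loses nothing.
    have hval : (l.map cls : Multiset (CTerm X)).toFinset.val = l.map cls :=
      Multiset.dedup_eq_self.2 (CTerm.nodup_of_irreducible h)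
    rw [nf_join, hl, hS,
      CTerm.joinNf_of_not_contradictory (CTerm.not_contradictory_of_irreducible h),
      CTerm.ofParts_of_ne, hval]
    intro c hc
    rw [hc] at hval
    exact hne c hval.symm

/-! ### Confluence and the word problem -/

/-- Reduction preserves `nf`, and the irreducible `n` is its own `nf`; uniqueness thus needs no
confluence. -/
theorem IsNormalFormOf.eq_nf {p n : CTerm X} (h : IsNormalFormOf Step p n) : n = CTerm.nf p := by
  rw [CTerm.nf_eq_of_eqvGen (Relation.EqvGen.reflTransGen_le_eqvGen _ _ _ h.1)]
  obtain ⟨t, rfl⟩ := Quotient.exists_rep n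
  exact (NTerm.nf_eq_cls_of_irreducible h.2).symm

theorem isNormalFormOf_nf (p : CTerm X) : IsNormalFormOf Step p (CTerm.nf p) := by
  obtain ⟨n, hn⟩ := exists_isNormalFormOf p
  exact hn.eq_nf ▸ hn

theorem confluent_step : Confluent (Step (X := X)) := by
  intro a b c hb hc
  refine ⟨CTerm.nf a, ?_, ?_⟩
  · rw [CTerm.nf_eq_of_eqvGen (Relation.EqvGen.reflTransGen_le_eqvGen _ _ _ hb)]
    exact (isNormalFormOf_nf b).1
  · rw [CTerm.nf_eq_of_eqvGen (Relation.EqvGen.reflTransGen_le_eqvGen _ _ _ hc)]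
    exact (isNormalFormOf_nf c).1

theorem eqvGen_step_iff {p q : CTerm X} : Relation.EqvGen Step p q ↔ CTerm.nf p = CTerm.nf q := by
  refine ⟨CTerm.nf_eq_of_eqvGen, fun h => ?_⟩
  have hq := (Relation.EqvGen.reflTransGen_le_eqvGen _ _ _ (isNormalFormOf_nf q).1).symm
  rw [← h] at hq
  exact (Relation.EqvGen.reflTransGen_le_eqvGen _ _ _ (isNormalFormOf_nf p).1).trans _ _ _ hq

end OCBSL

theorem mainTheorem2 (X : Type u) :
    -- the rewrite system modulo commutativity is terminating and confluent
    OCBSL.Terminating (OCBSL.Step (X := X)) ∧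
    OCBSL.Confluent (OCBSL.Step (X := X)) ∧
    -- derivability from the axioms is the same as validity in all structures
    (∀ s t : OCBSL.BTerm X, OCBSL.Derives s t ↔
      ∀ (S : Type (max u v)) [OCBSL.OrthoBisemilattice S] (a : X → S), s.eval a = t.eval a) ∧
    -- the system is equivalent to the axioms: the translations preserve and reflect equality
    (∀ s t : OCBSL.BTerm X, OCBSL.Derives s t ↔
      Relation.EqvGen OCBSL.Step s.deMorgan.cls t.deMorgan.cls) ∧
    (∀ p q : OCBSL.NTerm X, Relation.EqvGen OCBSL.Step p.cls q.cls ↔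
      OCBSL.Derives p.toBTerm q.toBTerm) ∧
    -- and they are inverse to each other up to equality in the two theories
    (∀ s : OCBSL.BTerm X, OCBSL.Derives s.deMorgan.toBTerm s) ∧
    (∀ p : OCBSL.NTerm X, Relation.EqvGen OCBSL.Step p.toBTerm.deMorgan.cls p.cls) ∧
    -- every term has a unique normal form
    (∀ p : OCBSL.CTerm X, ∃! n, OCBSL.IsNormalFormOf OCBSL.Step p n) ∧
    -- and two terms are equal in the theory iff their normal forms coincide
    (∀ nf : OCBSL.CTerm X → OCBSL.CTerm X,
      (∀ p, OCBSL.IsNormalFormOf OCBSL.Step p (nf p)) →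
        (∀ s t : OCBSL.BTerm X, OCBSL.Derives s t ↔
          nf s.deMorgan.cls = nf t.deMorgan.cls) ∧
        (∀ p q : OCBSL.NTerm X, OCBSL.Derives p.toBTerm q.toBTerm ↔
          nf p.cls = nf q.cls)) := by
  refine ⟨OCBSL.terminating_step, OCBSL.confluent_step, OCBSL.derives_iff_valid,
    OCBSL.derives_iff_conv, OCBSL.conv_iff_derives, OCBSL.derives_deMorgan_toBTerm,
    OCBSL.Conv.toBTerm_deMorgan,
    fun p => ⟨_, OCBSL.isNormalFormOf_nf p, fun _ h => h.eq_nf⟩, fun nf hnf => ?_⟩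
  -- Uniqueness identifies any choice of normal forms with the computed one.
  obtain rfl : nf = OCBSL.CTerm.nf := funext fun p => (hnf p).eq_nf
  exact ⟨fun s t => (OCBSL.derives_iff_conv s t).trans OCBSL.eqvGen_step_iff,
    fun p q => (OCBSL.conv_iff_derives p q).symm.trans OCBSL.eqvGen_step_iff⟩
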